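/- Throughout, faces of a polytope are nonempty (the polytope itself is one of its faces), $\mathcal F(P)$ is the set of faces of $P$, and simplices are given with their vertices. Let $P\subset\mathbb R^e$ be a nonempty polytope of dimension $d$. A \emph{pointed triangulation} of $P$ is a finite triangulation $\mathcal C_P$ of $P$ (a finite geometric simplicial complex with underlying set $P$) together with a vertex $\mathbf v_F$ of $F$, called the \emph{apex} of $F$, for each face $F$ of $P$, such that, with $\mathcal C_F=\{\sigma\in\mathcal C_P : \sigma\subseteq F\}$: (1) for each $k$-face $F$ of $P$, $\mathcal C_F$ is a triangulation of $F$ and $\mathbf v_F$ lies in every $k$-simplex of $\mathcal C_F$; (2) for all faces $F_1,F_2$ of $P$, if $\{\mathbf v_{F_1},\mathbf v_{F_2}\}\subseteq F_1\cap F_2$, then $\mathbf v_{F_1}=\mathbf v_{F_2}$; (3) for each face $F$ of $P$ and each vertex $\mathbf w\ne\mathbf v_F$ of $F$, the segment $\operatorname{conv}\{\mathbf v_F,\mathbf w\}$ is a simplex of $\mathcal C_F$. With $V(P)=\{\mathbf v_F : F\in\mathcal F(P)\}$, $\mathcal C_P$ is called a $V(P)$-pointed triangulation. For a polytope $Q$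 with a chosen vertex $\mathbf v_F$ for each face $F$ of $Q$, the \emph{polytope numbers} $Q(n)$ and the \emph{interior polytope numbers} $Q(n)^\sharp$, $n\ge 0$, are defined by induction on $\dim Q$ and $n$. If $\dim Q=0$, then $Q(0)=Q(0)^\sharp=0$ and $Q(n)=Q(n)^\sharp=1$ for $n\ge1$. If $\dim Q\ge1$, then $Q(0)=Q(0)^\sharp=0$, $Q(1)=1$, $Q(1)^\sharp=0$, and for $n\ge2$ $$Q(n)=Q(n-1)+\sum_{F\in\mathcal F(Q),\ \mathbf v_Q\notin F}F(n)^\sharp,\qquad Q(n)^\sharp=Q(n)-\sum_{F\in\mathcal F(Q)\setminus\{Q\}}F(n)^\sharp .$$ Let $\alpha^k(n)$ be the polytope numbers of the standard $k$-simplex $\operatorname{conv}\{\mathbf e_1,\dots,\mathbf e_{k+1}\}\subset\mathbb R^{k+1}$, where the apex of each face is the point of the face at which the linear function $\sum_{i=1}^{k+1} i\,x_i$ is minimal; put $\alpha^k(m)=0$ for integers $m\le 0$. \textbf{Theorem (Decomposition theorem 3-1).} Let $\mathcal C_P$ be a $V(P)$-pointed triangulation of $P$ and let $P(n)$ be the polytope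 numbers of $P$ for the apexes $\mathbf v_F$. Then for all $n\ge 0$ $$P(n)=\sum_{k=0}^{d}c_k\,\alpha^k(n-k),$$ where $c_k$ is the number of $k$-simplices of $\mathcal C_P$ that contain the apex $\mathbf v_P$ of $P$. -/

import Mathlib

namespace PolytopeNumbers

noncomputable section

section General

variable {E : Type*} [NormedAddCommGroup E] [NormedSpace ℝ E]

/-- A polytope: the convex hull of a finite set of points. -/
def IsPolytope (P : Set E) : Prop :=
  ∃ s : Set E, s.Finite ∧ P = convexHull ℝ s

/-- `F` is a nonempty face of `P`: either `P` itself or the intersection of `P` with a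
supporting hyperplane. -/
def IsFace (P F : Set E) : Prop :=
  F.Nonempty ∧ IsExposed ℝ P F

/-- The dimension of the affine hull of `P`. -/
def dim (P : Set E) : ℕ :=
  Module.finrank ℝ (vectorSpan ℝ P)

/-- A proper face has smaller dimension. -/
theorem dim_lt_of_isFace [FiniteDimensional ℝ E] {P F : Set E}
    (hF : IsFace P F) (hne : F ≠ P) : dim F < dim P := by
  obtain ⟨⟨x, hx⟩, hexp⟩ := hF
  obtain ⟨l, hl⟩ := hexp ⟨x, hx⟩
  have hsub : F ⊆ P := by
    rw [hl]
    exact fun y hy => hy.1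
  obtain ⟨y, hyP, hyF⟩ : ∃ y ∈ P, y ∉ F := by
    by_contra h
    push Not at h
    exact hne (Set.Subset.antisymm hsub h)
  have hmax : ∀ u ∈ F, ∀ w ∈ P, l w ≤ l u := by
    intro u hu
    rw [hl] at hu
    exact hu.2
  have hker : vectorSpan ℝ F ≤ LinearMap.ker l.toLinearMap := by
    rw [vectorSpan_def, Submodule.span_le]
    rintro _ ⟨a, ha, b, hb, rfl⟩
    have h1 := hmax a ha b (hsub hb)
    have h2 := hmax b hb a (hsub ha)
    have h3 : l a = l b := le_antisymm h2 h1
    simp [h3]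
  have hylt : l y < l x := by
    rcases lt_or_eq_of_le (hmax x hx y hyP) with h | h
    · exact h
    · exact absurd (by rw [hl]; exact ⟨hyP, fun w hw => h ▸ hmax x hx w hw⟩) hyF
  refine Submodule.finrank_lt_finrank_of_lt (lt_of_le_of_ne (vectorSpan_mono ℝ hsub) ?_)
  intro heq
  have hmem : y - x ∈ vectorSpan ℝ F := by
    rw [heq]
    exact vsub_mem_vectorSpan ℝ hyP (hsub hx)
  have h0 : l (y - x) = 0 := by
    simpa using hker hmem
  rw [map_sub] at h0
  linarith

mutual

/-- The polytope numbers `P(n)` of the polytope `P`, where `v F` is the apex chosen for the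
face `F`. Since the apex of `P` belongs to `P`, the sum runs over all the faces of `P` that do
not contain the apex of `P`. -/
def polytopeNumber [FiniteDimensional ℝ E] (v : Set E → E) (P : Set E) (n : ℕ) : ℤ :=
  match n with
  | 0 => 0
  | 1 => 1
  | m + 2 =>
    if dim P = 0 then 1
    else polytopeNumber v P (m + 1) +
      ∑ᶠ F : {F : Set E // (IsFace P F ∧ F ≠ P) ∧ v P ∉ F}, interiorNumber v F.1 (m + 2)
termination_by (dim P, n, 0)
decreasing_by
  · exact Prod.Lex.right _ (Prod.Lex.left _ _ (by omega))
  · exact Prod.Lex.left _ _ (dim_lt_of_isFace F.2.1.1 F.2.1.2)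

/-- The interior polytope numbers `P(n)♯` of the polytope `P`, where `v F` is the apex chosen
for the face `F`. -/
def interiorNumber [FiniteDimensional ℝ E] (v : Set E → E) (P : Set E) (n : ℕ) : ℤ :=
  if dim P = 0 then (if n = 0 then 0 else 1)
  else if n ≤ 1 then 0
  else polytopeNumber v P n -
    ∑ᶠ F : {F : Set E // IsFace P F ∧ F ≠ P}, interiorNumber v F.1 n
termination_by (dim P, n, 1)
decreasing_by
  · exact Prod.Lex.right _ (Prod.Lex.right _ (by omega))
  · exact Prod.Lex.left _ _ (dim_lt_of_isFace F.2.1 F.2.2)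

end

/-- The simplices of `C` contained in `F`. -/
def restrictFaces (C : Geometry.SimplicialComplex ℝ E) (F : Set E) : Set (Finset E) :=
  {s | s ∈ C.faces ∧ convexHull ℝ (s : Set E) ⊆ F}

/-- `C` is a pointed triangulation of the polytope `P`, and `v F` is the apex of each
nonempty face `F` of `P`. A simplex is represented by the finite set of its vertices. -/
structure IsPointedTriangulation (P : Set E) (C : Geometry.SimplicialComplex ℝ E)
    (v : Set E → E) : Prop where
  finite : C.faces.Finite
  space_eq : C.space = P
  /-- each face is triangulated by the simplices of `C` that it contains -/
  triangulates : ∀ F, IsFace P F → ⋃ s ∈ restrictFaces C F, convexHull ℝ (s : Set E) = F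
  apex_mem_vertices : ∀ F, IsFace P F → v F ∈ F.extremePoints ℝ
  /-- the apex of a `k`-face lies in all the `k`-simplices of the triangulation of that face -/
  apex_mem_simplex : ∀ F, IsFace P F → ∀ s ∈ restrictFaces C F,
    s.card = dim F + 1 → v F ∈ convexHull ℝ (s : Set E)
  apex_coherent : ∀ F₁ F₂, IsFace P F₁ → IsFace P F₂ →
    v F₁ ∈ F₁ ∩ F₂ → v F₂ ∈ F₁ ∩ F₂ → v F₁ = v F₂
  edge_mem : ∀ F, IsFace P F → ∀ w ∈ F.extremePoints ℝ, w ≠ v F →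
    ∃ s ∈ restrictFaces C F, (s : Set E) = {v F, w}

/-- The set of `k`-simplices of `C` that contain the point `x`. -/
def simplicesThrough (C : Geometry.SimplicialComplex ℝ E) (x : E) (k : ℕ) :
    Set (Finset E) :=
  {s | s ∈ C.faces ∧ s.card = k + 1 ∧ x ∈ convexHull ℝ (s : Set E)}

end General

/-- The standard `k`-simplex, the convex hull of the unit vectors of `ℝ^(k+1)`. -/
def standardSimplex (k : ℕ) : Set (EuclideanSpace ℝ (Fin (k + 1))) :=
  convexHull ℝ (Set.range fun i => EuclideanSpace.single i (1 : ℝ))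

/-- The apex of a face `F` of the standard `k`-simplex: the point of `F` where the linear
function `x ↦ ∑ i, (i + 1) * x i` is minimal. -/
def standardSimplexApex (k : ℕ) (F : Set (EuclideanSpace ℝ (Fin (k + 1)))) :
    EuclideanSpace ℝ (Fin (k + 1)) :=
  Classical.epsilon fun x =>
    x ∈ F ∧ ∀ y ∈ F, ∑ i : Fin (k + 1), (((i : ℕ) : ℝ) + 1) * x i ≤
      ∑ i : Fin (k + 1), (((i : ℕ) : ℝ) + 1) * y i

/-- The `k`-simplex numbers `α^k(m)`: the polytope numbers of the standard `k`-simplex,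
extended by `0` to negative arguments `m`. -/
def simplexNumber (k : ℕ) (m : ℤ) : ℤ :=
  polytopeNumber (standardSimplexApex k) (standardSimplex k) m.toNat

end

end PolytopeNumbers

/-!
In a triangulation of a polytope all of whose full-dimensional simplices have the apex as a vertex,
the simplices form a cone: the apex can be added to every simplex, because the centroid of the
simplex lies in a full-dimensional simplex. By induction on the dimension and on `n`, the number
`P(n)` counts the points with barycentric coordinates in `(1 / n)ℤ` in the open simplices that have
the apex as a vertex, and for `n ≥ 2` the interior number `P(n)♯` counts the points with barycentric
coordinates in `(1 / (n - 1))ℤ` in the open simplices that lie in no proper face. Indeed Pascal's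
rule for the cone turns the first count into the count with denominator `n - 1` over all the open
simplices, and these are split, as in the recursion, according to the smallest face of `P` that
contains them; this face contains the apex exactly when the simplex does. For a simplex,
triangulated by its faces, the count is a binomial coefficient by Vandermonde's identity, and
grouping the simplices through the apex by dimension gives the theorem.
-/

namespace PolytopeNumbers

open Set Geometry

section Farkas

variable {𝕜 V ι : Type*} [Field 𝕜] [LinearOrder 𝕜] [IsStrictOrderedRing 𝕜] [AddCommGroup V]
  [Module 𝕜 V]

theorem nonneg_of_mem_hull {s : Set V} {l : Module.Dual 𝕜 V} (hl : ∀ y ∈ s, 0 ≤ l y) {x : V}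
    (hx : x ∈ PointedCone.hull 𝕜 s) : 0 ≤ l x := by
  have hle : PointedCone.hull 𝕜 s ≤ (PointedCone.positive 𝕜 𝕜).comap l :=
    Submodule.span_le.2 fun y hy => by simpa using hl y hy
  simpa using hle hx

/- The map `π` is the projection onto `ker l` along `a`. -/
theorem mem_hull_insert_of_map_mem_hull_image {s : Set V} {l : Module.Dual 𝕜 V} {a b : V}
    (hl : ∀ y ∈ s, 0 ≤ l y) (hla : l a < 0) (hlb : l b ≤ 0) {π : V →ₗ[𝕜] V}
    (hπ : ∀ y, π y = y - (l y / l a) • a) (hb : π b ∈ PointedCone.hull 𝕜 (π '' s)) :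
    b ∈ PointedCone.hull 𝕜 (insert a s) := by
  obtain ⟨z, hz, hzb⟩ : π b ∈ (PointedCone.hull 𝕜 s).map π := by
    simpa [PointedCone.map, PointedCone.hull, Submodule.map_span] using hb
  have hc : 0 ≤ l b / l a - l z / l a := by
    rw [← sub_div]
    exact div_nonneg_of_nonpos (by linarith [nonneg_of_mem_hull hl hz]) hla.le
  have hbz : b = z + (l b / l a - l z / l a) • a := by
    have hzb : z - (l z / l a) • a = b - (l b / l a) • a := by
      rw [← hπ, ← hπ]
      exact hzb
    linear_combination (norm := module) (-1 : 𝕜) • hzb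
  rw [hbz]
  exact add_mem (Submodule.span_mono (subset_insert _ _) hz)
    (PointedCone.smul_mem _ hc (Submodule.subset_span (mem_insert _ _)))

theorem exists_dual_neg_of_notMem_hull_image (s : Finset ι) (f : ι → V) (b : V)
    (hb : b ∉ PointedCone.hull 𝕜 (f '' s)) :
    ∃ l : Module.Dual 𝕜 V, (∀ i ∈ s, 0 ≤ l (f i)) ∧ l b < 0 := by
  classical
  induction s using Finset.induction_on generalizing f b with
  | empty =>
    obtain ⟨l, hl⟩ := Module.Projective.exists_dual_ne_zero 𝕜 (x := b) (by simpa using hb)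
    rcases hl.lt_or_gt with hneg | hpos
    · exact ⟨l, by simp, hneg⟩
    · exact ⟨-l, by simp, by simpa using hpos⟩
  | insert a s _ ih =>
    rw [Finset.coe_insert, image_insert_eq] at hb
    obtain ⟨l, hl, hlb⟩ := ih f b fun h => hb (Submodule.span_mono (subset_insert _ _) h)
    rcases le_or_gt 0 (l (f a)) with hla | hla
    · exact ⟨l, Finset.forall_mem_insert _ _ _ |>.2 ⟨hla, hl⟩, hlb⟩
    set π : V →ₗ[𝕜] V := LinearMap.id - ((l (f a))⁻¹ • l).smulRight (f a) with hπ
    have hπ_apply (y : V) : π y = y - (l y / l (f a)) • f a := by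
      simp [hπ, div_eq_inv_mul]
    have hπb : π b ∉ PointedCone.hull 𝕜 ((π ∘ f) '' s) := fun h =>
      hb (mem_hull_insert_of_map_mem_hull_image (by simpa using hl) hla hlb.le hπ_apply
        (image_comp π f s ▸ h))
    obtain ⟨m, hm, hmb⟩ := ih (π ∘ f) (π b) hπb
    refine ⟨m ∘ₗ π, Finset.forall_mem_insert _ _ _ |>.2 ⟨?_, hm⟩, hmb⟩
    simp [hπ_apply, hla.ne]

end Farkas

theorem le_of_mem_convexHull {𝕜 V : Type*} [Field 𝕜] [LinearOrder 𝕜] [IsStrictOrderedRing 𝕜]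
    [AddCommGroup V] [Module 𝕜 V] {s : Set V} {φ : V →ᵃ[𝕜] 𝕜} {c : 𝕜} (h : ∀ y ∈ s, φ y ≤ c)
    {x : V} (hx : x ∈ convexHull 𝕜 s) : φ x ≤ c :=
  convexHull_min (t := φ ⁻¹' Iic c) h ((convex_Iic c).affine_preimage φ) hx

theorem exists_pos_add_smul_mem_of_mem_hull {𝕜 V : Type*} [Field 𝕜] [LinearOrder 𝕜]
    [IsStrictOrderedRing 𝕜] [AddCommGroup V] [Module 𝕜 V] {P : Set V} (hP : Convex 𝕜 P) {x b : V}
    (hx : x ∈ P) (hb : b ∈ PointedCone.hull 𝕜 ((· - x) '' P)) :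
    ∃ ε : 𝕜, 0 < ε ∧ x + ε • b ∈ P := by
  have hconv : Convex 𝕜 ((· - x) '' P) := by
    simpa [sub_eq_neg_add] using hP.translate (-x)
  have hpointed : (ConvexCone.hull 𝕜 ((· - x) '' P)).Pointed :=
    ConvexCone.subset_hull ⟨x, hx, sub_self x⟩
  have hle : PointedCone.hull 𝕜 ((· - x) '' P) ≤ ConvexCone.toPointedCone _ hpointed :=
    Submodule.span_le.2 ConvexCone.subset_hull
  obtain ⟨c, hc, _, ⟨y, hy, rfl⟩, rfl⟩ := (ConvexCone.mem_hull_of_convex hconv).1 (hle hb)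
  exact ⟨c⁻¹, inv_pos.2 hc, by simpa [inv_smul_smul₀ hc.ne'] using hy⟩

section Faces

variable {E : Type*} [NormedAddCommGroup E] [NormedSpace ℝ E] {P F G A : Set E}

theorem IsPolytope.convex (hP : IsPolytope P) : Convex ℝ P := by
  obtain ⟨s, -, rfl⟩ := hP
  exact convex_convexHull ℝ s

theorem IsFace.refl (h : P.Nonempty) : IsFace P P := ⟨h, IsExposed.refl P⟩

theorem IsFace.subset (h : IsFace P F) : F ⊆ P := h.2.subset

theorem IsFace.of_subset (hF : IsFace P F) (hG : IsFace P G) (h : G ⊆ F) : IsFace F G :=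
  ⟨hG.1, hG.2.mono hF.subset h⟩

theorem isFace_sep_eq {l : StrongDual ℝ E} {c : ℝ} (hl : ∀ y ∈ P, l y ≤ c)
    (hne : {y ∈ P | l y = c}.Nonempty) : IsFace P {y ∈ P | l y = c} := by
  obtain ⟨x, hx, hxc⟩ := hne
  refine ⟨⟨x, hx, hxc⟩, fun _ => ⟨l, ?_⟩⟩
  ext y
  exact ⟨fun hy => ⟨hy.1, fun z hz => hy.2 ▸ hl z hz⟩,
    fun hy => ⟨hy.1, (hl y hy.1).antisymm (hxc ▸ hy.2 x hx)⟩⟩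

theorem IsFace.exists_eq_sep (hF : IsFace P F) :
    ∃ (l : StrongDual ℝ E) (c : ℝ), (∀ y ∈ P, l y ≤ c) ∧ F = {y ∈ P | l y = c} := by
  obtain ⟨l, hl⟩ := hF.2 hF.1
  obtain ⟨x, hx⟩ := hF.1
  rw [hl] at hx
  refine ⟨l, l x, hx.2, ?_⟩
  ext y
  rw [hl]
  exact ⟨fun hy => ⟨hy.1, (hx.2 y hy.1).antisymm (hy.2 x hx.1)⟩,
    fun hy => ⟨hy.1, fun z hz => hy.2 ▸ hx.2 z hz⟩⟩

theorem IsPolytope.exists_pos_add_smul_mem [FiniteDimensional ℝ E] (hP : IsPolytope P) {x v : E}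
    (hx : x ∈ P) (h : ∀ F, IsFace P F → x ∈ F → v ∈ F) :
    ∃ ε : ℝ, 0 < ε ∧ x + ε • (x - v) ∈ P := by
  have hconv := hP.convex
  obtain ⟨s, hs, rfl⟩ := hP
  lift s to Finset E using hs
  by_cases hmem : x - v ∈ PointedCone.hull ℝ ((· - x) '' (s : Set E))
  · exact exists_pos_add_smul_mem_of_mem_hull hconv hx
      (Submodule.span_mono (image_mono (subset_convexHull ℝ _)) hmem)
  obtain ⟨l, hl, hlv⟩ := exists_dual_neg_of_notMem_hull_image s (· - x) (x - v) hmem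
  simp only [map_sub, sub_nonneg, sub_neg] at hl hlv
  have hmax : ∀ y ∈ convexHull ℝ (s : Set E), (-l.toContinuousLinearMap) y ≤ -l x := fun y hy =>
    le_of_mem_convexHull (φ := (-l).toAffineMap) (fun z hz => by simpa using hl z hz) hy
  have hv := (h _ (isFace_sep_eq hmax ⟨x, hx, rfl⟩) ⟨hx, rfl⟩).2
  exact absurd (neg_injective hv) hlv.ne'

theorem IsFace.eq_convexHull_inter {s : Set E} (hs : s.Finite)
    (hF : IsFace (convexHull ℝ s) F) : F = convexHull ℝ (s ∩ F) := by
  have hcompact : IsCompact F := hF.2.isCompact (hs.isCompact_convexHull ℝ)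
  have hconv : Convex ℝ F := hF.2.convex (convex_convexHull ℝ s)
  refine subset_antisymm ?_ (convexHull_min inter_subset_right hconv)
  have hsub : F.extremePoints ℝ ⊆ s ∩ F := fun x hx =>
    ⟨extremePoints_convexHull_subset (hF.2.isExtreme.extremePoints_subset_extremePoints hx), hx.1⟩
  calc F = closure (convexHull ℝ (F.extremePoints ℝ)) :=
        (closure_convexHull_extremePoints hcompact hconv).symm
    _ ⊆ convexHull ℝ (s ∩ F) :=
        closure_minimal (convexHull_mono hsub) ((hs.inter_of_left F).isClosed_convexHull ℝ)

theorem IsPolytope.of_isFace (hP : IsPolytope P) (hF : IsFace P F) : IsPolytope F := by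
  obtain ⟨s, hs, rfl⟩ := hP
  exact ⟨s ∩ F, hs.inter_of_left F, hF.eq_convexHull_inter hs⟩

theorem IsPolytope.finite_setOf_isFace (hP : IsPolytope P) : {F | IsFace P F}.Finite := by
  obtain ⟨s, hs, rfl⟩ := hP
  exact (hs.finite_subsets.image (convexHull ℝ)).subset fun F hF =>
    ⟨s ∩ F, inter_subset_left, (IsFace.eq_convexHull_inter hs hF).symm⟩

theorem exists_pos_forall_add_mul_lt {ι : Type*} {s : Set ι} (hs : s.Finite) {f g : ι → ℝ}
    {c d : ℝ} (h : ∀ i ∈ s, f i < c) : ∃ ε > 0, ∀ i ∈ s, f i + ε * g i < c + ε * d := by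
  have hsmall : ∀ᶠ ε in nhdsWithin (0 : ℝ) (Ioi 0), ∀ i ∈ s, f i + ε * g i < c + ε * d := by
    rw [Filter.eventually_all_finite hs]
    intro i hi
    have hf : ContinuousAt (fun ε => f i + ε * g i) 0 := by fun_prop
    have hc : ContinuousAt (fun ε => c + ε * d) 0 := by fun_prop
    exact (hf.eventually_lt hc (by simpa using h i hi)).filter_mono nhdsWithin_le_nhds
  obtain ⟨ε, hε, hpos⟩ := (hsmall.and self_mem_nhdsWithin).exists
  exact ⟨ε, hpos, hε⟩

theorem exists_pos_tilt {s : Set E} (hs : s.Finite) {l m : StrongDual ℝ E} {c d : ℝ}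
    (hl : ∀ y ∈ s, l y ≤ c) (hm : ∀ y ∈ s, l y = c → m y ≤ d) :
    ∃ ε > 0, (∀ y ∈ convexHull ℝ s, (l + ε • m) y ≤ c + ε * d) ∧
      ∀ y ∈ s, (l + ε • m) y = c + ε * d → l y = c := by
  obtain ⟨ε, hε, hlt⟩ : ∃ ε > 0, ∀ y ∈ {y ∈ s | l y ≠ c}, l y + ε * m y < c + ε * d :=
    exists_pos_forall_add_mul_lt (hs.sep _) fun y hy => (hl y hy.1).lt_of_ne hy.2
  refine ⟨ε, hε, fun y hy => ?_, fun y hy hyc => by_contra fun h => (hlt y ⟨hy, h⟩).ne hyc⟩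
  refine le_of_mem_convexHull (φ := (l + ε • m).toLinearMap.toAffineMap) (fun z hz => ?_) hy
  by_cases hzc : l z = c
  · exact add_le_add hzc.le (mul_le_mul_of_nonneg_left (hm z hz hzc) hε.le)
  · exact (hlt z ⟨hz, hzc⟩).le

theorem IsFace.trans (hP : IsPolytope P) (hF : IsFace P F) (hG : IsFace F G) : IsFace P G := by
  have hGconv : Convex ℝ G := ((hP.of_isFace hF).of_isFace hG).convex
  obtain ⟨s, hs, rfl⟩ := hP
  obtain ⟨l, c, hl, rfl⟩ := hF.exists_eq_sep
  obtain ⟨m, d, hm, rfl⟩ := hG.exists_eq_sep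
  have hsP := subset_convexHull ℝ s
  -- Tilting the hyperplane supporting `F` slightly towards that of `G` cuts out exactly `G`.
  obtain ⟨ε, hε, hle, heq⟩ := exists_pos_tilt hs (fun y hy => hl y (hsP hy))
    fun y hy hyc => hm y ⟨hsP hy, hyc⟩
  have hsub : {y ∈ {y ∈ convexHull ℝ s | l y = c} | m y = d} ⊆
      {y ∈ convexHull ℝ s | (l + ε • m) y = c + ε * d} :=
    fun y ⟨⟨hy, hyc⟩, hyd⟩ => ⟨hy, by simp [hyc, hyd]⟩
  have hface := isFace_sep_eq hle (hG.1.mono hsub)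
  rwa [hsub.antisymm ?_]
  rw [hface.eq_convexHull_inter hs]
  refine convexHull_min (fun y ⟨hys, _, hy⟩ => ?_) hGconv
  have hyc := heq y hys hy
  exact ⟨⟨hsP hys, hyc⟩, mul_left_cancel₀ hε.ne' (by simpa [hyc] using hy)⟩

/-- The smallest face of `P` containing `A`. -/
def carrier (P A : Set E) : Set E := ⋂₀ {F | IsFace P F ∧ A ⊆ F}

theorem subset_carrier (P A : Set E) : A ⊆ carrier P A := subset_sInter fun _ hF => hF.2

theorem carrier_subset (hF : IsFace P F) (hA : A ⊆ F) : carrier P A ⊆ F :=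
  sInter_subset_of_mem ⟨hF, hA⟩

theorem IsPolytope.isFace_carrier (hP : IsPolytope P) (hne : A.Nonempty) (hA : A ⊆ P) :
    IsFace P (carrier P A) := by
  refine ⟨hne.mono (subset_carrier P A), ?_⟩
  have hfin : {F | IsFace P F ∧ A ⊆ F}.Finite := hP.finite_setOf_isFace.subset fun F hF => hF.1
  have hexposed := IsExposed.sInter (𝕜 := ℝ) (A := P) (F := hfin.toFinset)
    ⟨P, by simpa using ⟨IsFace.refl (hne.mono hA), hA⟩⟩
    fun F hF => (hfin.mem_toFinset.1 hF).1.2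
  simpa [carrier] using hexposed

theorem IsPolytope.carrier_eq_of_isFace (hP : IsPolytope P) (hF : IsFace P F) (hne : A.Nonempty)
    (hA : A ⊆ F) : carrier F A = carrier P A := by
  have hface := hP.isFace_carrier hne (hA.trans hF.subset)
  exact (carrier_subset (hF.of_subset hface (carrier_subset hF hA)) (subset_carrier P A)).antisymm
    (subset_sInter fun G hG => carrier_subset (hF.trans hP hG.1) hG.2)

end Faces

theorem exists_affineMap_indicator {𝕜 V : Type*} [Field 𝕜] [AddCommGroup V] [Module 𝕜 V]
    {s : Set V} (hs : AffineIndependent 𝕜 ((↑) : s → V)) {v : V} (hv : v ∈ s) :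
    ∃ φ : V →ᵃ[𝕜] 𝕜, φ v = 1 ∧ ∀ y ∈ s, y ≠ v → φ y = 0 := by
  obtain ⟨u, hsu, hu, hspan⟩ := exists_subset_affineIndependent_affineSpan_eq_top hs
  let b : AffineBasis u 𝕜 V := ⟨(↑), hu, by simpa using hspan⟩
  refine ⟨b.coord ⟨v, hsu hv⟩, b.coord_apply_eq ⟨v, hsu hv⟩, fun y hy hyv => ?_⟩
  exact b.coord_apply_ne (i := ⟨v, hsu hv⟩) (j := ⟨y, hsu hy⟩) (by simpa [eq_comm] using hyv)

section AffineCombinations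

variable {𝕜 V : Type*} [Field 𝕜] [LinearOrder 𝕜] [IsStrictOrderedRing 𝕜] [AddCommGroup V]
  [Module 𝕜 V] {t r : Finset V}

theorem eqOn_of_apply_centroid_eq {φ : V →ᵃ[𝕜] 𝕜} {c : 𝕜} (hφ : ∀ y ∈ t, φ y ≤ c)
    (ht : t.Nonempty) (h : φ (t.centroid 𝕜 id) = c) : ∀ y ∈ t, φ y = c := by
  have hweights : ∑ _y ∈ t, (t.card : 𝕜)⁻¹ = 1 := t.sum_centroidWeights_eq_one_of_nonempty 𝕜 ht
  have hpos : 0 < (t.card : 𝕜)⁻¹ := by simpa using ht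
  have hsum : ∑ y ∈ t, (t.card : 𝕜)⁻¹ * φ y = ∑ _y ∈ t, (t.card : 𝕜)⁻¹ * c := by
    rw [← Finset.sum_mul, hweights, one_mul, ← h]
    exact (t.map_affineCombination id _ hweights φ ▸
      t.affineCombination_eq_linear_combination _ _ hweights).symm
  intro y hy
  exact mul_left_cancel₀ hpos.ne' ((Finset.sum_eq_sum_iff_of_le fun z hz =>
    mul_le_mul_of_nonneg_left (hφ z hz) hpos.le).1 hsum y hy)

theorem subset_of_centroid_mem_convexHull (ht : AffineIndependent 𝕜 ((↑) : t → V))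
    (hne : t.Nonempty) (h : t.centroid 𝕜 id ∈ convexHull 𝕜 (t ∩ r : Set V)) : t ⊆ r := by
  intro v hv
  by_contra hvr
  obtain ⟨φ, hφv, hφ⟩ := exists_affineMap_indicator ht (Finset.mem_coe.2 hv)
  have hzero : ∀ y ∈ (t ∩ r : Set V), φ y = 0 := fun y hy =>
    hφ y hy.1 fun hyv => hvr (hyv ▸ hy.2)
  have hnonpos : ∀ y ∈ t, (-φ) y ≤ 0 := fun y hy => by
    by_cases hyv : y = v
    · simp [hyv, hφv]
    · simp [hφ y hy hyv]
  have hcentroid : (-φ) (t.centroid 𝕜 id) = 0 := le_antisymm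
    (le_of_mem_convexHull (fun y hy => by simp [hzero y hy]) h)
    (neg_nonneg.2 (le_of_mem_convexHull (fun y hy => (hzero y hy).le) h))
  simpa [hφv] using eqOn_of_apply_centroid_eq hnonpos hne hcentroid v hv

theorem mem_of_add_smul_mem_convexHull (hr : AffineIndependent 𝕜 ((↑) : r → V)) (htr : t ⊆ r)
    {x v : V} (hv : v ∈ r) (hx : x ∈ convexHull 𝕜 (t : Set V)) {ε : 𝕜} (hε : 0 < ε)
    (hy : x + ε • (x - v) ∈ convexHull 𝕜 (r : Set V)) : v ∈ t := by
  by_contra hvt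
  obtain ⟨φ, hφv, hφ⟩ := exists_affineMap_indicator hr (Finset.mem_coe.2 hv)
  have hzero : ∀ y ∈ (t : Set V), φ y = 0 := fun y hy => hφ y (htr hy) fun h => hvt (h ▸ hy)
  have hnonpos : ∀ y ∈ (r : Set V), (-φ) y ≤ 0 := fun y hy => by
    by_cases hyv : y = v
    · simp [hyv, hφv]
    · simp [hφ y hy hyv]
  have hφx : φ x ≤ 0 := le_of_mem_convexHull (fun y hy => (hzero y hy).le) hx
  have hφy : 0 ≤ φ (x + ε • (x - v)) := neg_nonpos.1 (le_of_mem_convexHull hnonpos hy)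
  have hext : φ (x + ε • (x - v)) = φ x + ε * (φ x - φ v) := by
    rw [add_comm, ← vadd_eq_add, AffineMap.map_vadd, map_smul, ← vsub_eq_sub,
      AffineMap.linearMap_vsub]
    simp [add_comm]
  nlinarith

end AffineCombinations

section Dimension

variable {E : Type*} [NormedAddCommGroup E] [NormedSpace ℝ E]

theorem dim_add_one_of_affineIndependent {t : Finset E} (ht : AffineIndependent ℝ ((↑) : t → E))
    (hne : t.Nonempty) : dim (t : Set E) + 1 = t.card := by
  have := hne.to_subtype
  have hrank : dim (range ((↑) : t → E)) + 1 = Fintype.card t := ht.finrank_vectorSpan_add_one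
  rwa [show range ((↑) : t → E) = t from Subtype.range_coe, Fintype.card_coe] at hrank

theorem dim_convexHull (s : Set E) : dim (convexHull ℝ s) = dim s := by
  rw [dim, ← direction_affineSpan, affineSpan_convexHull, direction_affineSpan, dim]

variable {P Q : Set E}

theorem dim_le_of_subset_affineSpan [FiniteDimensional ℝ E] (h : P ⊆ affineSpan ℝ Q) :
    dim P ≤ dim Q := by
  rw [dim, dim, ← direction_affineSpan, ← direction_affineSpan]
  exact Submodule.finrank_mono (AffineSubspace.direction_le (affineSpan_le.2 h))

theorem subset_closure_sdiff_affineSubspace (hP : Convex ℝ P) {A : AffineSubspace ℝ E}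
    (h : ¬P ⊆ A) : P ⊆ closure (P \ A) := by
  obtain ⟨y, hy, hyA⟩ := not_subset.1 h
  intro x hx
  by_cases hxA : x ∈ A
  · refine closure_mono ?_ (segment_subset_closure_openSegment (left_mem_segment ℝ x y))
    intro z hz
    refine ⟨hP.openSegment_subset hx hy hz, fun hzA => hyA ?_⟩
    rw [openSegment_eq_image_lineMap] at hz
    obtain ⟨c, hc, rfl⟩ := hz
    simpa [AffineMap.lineMap_apply, smul_smul, hc.1.ne'] using
      AffineMap.lineMap_mem c⁻¹ hxA hzA
  · exact subset_closure ⟨hx, hxA⟩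

theorem subset_closure_sdiff_biUnion_affineSubspace [FiniteDimensional ℝ E] (hP : Convex ℝ P)
    {ι : Type*} {s : Set ι} (hs : s.Finite) {A : ι → AffineSubspace ℝ E} (h : ∀ i ∈ s, ¬P ⊆ A i) :
    P ⊆ closure (P \ ⋃ i ∈ s, (A i : Set E)) := by
  induction s, hs using Set.Finite.induction_on with
  | empty => simpa using subset_closure
  | @insert a s _ hs ih =>
    have hopen : IsOpen (⋃ i ∈ s, (A i : Set E))ᶜ :=
      (hs.isClosed_biUnion fun i _ => (A i).closed_of_finiteDimensional).isOpen_compl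
    calc P ⊆ closure (P \ ⋃ i ∈ s, (A i : Set E)) := ih fun i hi => h i (mem_insert_of_mem a hi)
      _ ⊆ closure ((⋃ i ∈ s, (A i : Set E))ᶜ ∩ closure (P \ A a)) := closure_mono fun x hx =>
          ⟨hx.2, subset_closure_sdiff_affineSubspace hP (h a (mem_insert a s)) hx.1⟩
      _ ⊆ closure ((⋃ i ∈ s, (A i : Set E))ᶜ ∩ (P \ A a)) :=
          closure_minimal hopen.inter_closure isClosed_closure
      _ = closure (P \ ⋃ i ∈ insert a s, (A i : Set E)) := by
          rw [biUnion_insert, ← sdiff_sdiff, inter_comm, ← sdiff_eq]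

theorem exists_mem_convexHull_dim_eq [FiniteDimensional ℝ E] (hP : Convex ℝ P)
    {T : Set (Finset E)} (hT : T.Finite) (hcover : ⋃ t ∈ T, convexHull ℝ (t : Set E) = P)
    {x : E} (hx : x ∈ P) :
    ∃ t ∈ T, dim (t : Set E) = dim P ∧ x ∈ convexHull ℝ (t : Set E) := by
  have hsub : ∀ t ∈ T, (t : Set E) ⊆ P := fun t ht => (subset_convexHull ℝ _).trans
    (hcover ▸ subset_biUnion_of_mem (u := fun t : Finset E => convexHull ℝ (t : Set E)) ht)
  have hthin : ∀ t ∈ {t ∈ T | dim (t : Set E) ≠ dim P}, ¬P ⊆ affineSpan ℝ (t : Set E) :=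
    fun t ht hPt => ht.2 <| le_antisymm
      (dim_le_of_subset_affineSpan ((hsub t ht.1).trans (subset_affineSpan ℝ P)))
      (dim_le_of_subset_affineSpan hPt)
  have hclosed : IsClosed (⋃ t ∈ {t ∈ T | dim (t : Set E) = dim P}, convexHull ℝ (t : Set E)) :=
    (hT.sep _).isClosed_biUnion fun t _ => t.finite_toSet.isClosed_convexHull ℝ
  have hfull := closure_minimal (fun y hy => ?_) hclosed
    (subset_closure_sdiff_biUnion_affineSubspace hP (hT.sep _) hthin hx)
  · simpa [and_assoc] using hfull
  obtain ⟨hyP, hy⟩ := hy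
  rw [← hcover] at hyP
  simp only [mem_iUnion, mem_sep_iff, not_exists, exists_prop] at hyP hy ⊢
  obtain ⟨t, ht, hyt⟩ := hyP
  exact ⟨t, ⟨ht, not_not.1 fun h => hy t ⟨⟨ht, h⟩, convexHull_subset_affineSpan _ hyt⟩⟩, hyt⟩

end Dimension

theorem mem_segment_add_smul_sub {𝕜 V : Type*} [Field 𝕜] [LinearOrder 𝕜] [IsStrictOrderedRing 𝕜]
    [AddCommGroup V] [Module 𝕜 V] {ε : 𝕜} (hε : 0 ≤ ε) (x v : V) :
    x ∈ segment 𝕜 (x + ε • (x - v)) v := by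
  have hpos : 0 < 1 + ε := by positivity
  refine ⟨(1 + ε)⁻¹, (1 + ε)⁻¹ * ε, by positivity, by positivity, by field_simp, ?_⟩
  have hx : x + ε • (x - v) + ε • v = (1 + ε) • x := by module
  rw [mul_smul, ← smul_add, hx, inv_smul_smul₀ hpos.ne']

section ApexTriangulation

variable {E : Type*} [NormedAddCommGroup E] [NormedSpace ℝ E] {P F : Set E}
  {C : SimplicialComplex ℝ E} {v : Set E → E} {s t : Finset E}

theorem subset_of_centroid_mem (ht : t ∈ C.faces) (hs : s ∈ C.faces)
    (h : t.centroid ℝ id ∈ convexHull ℝ (s : Set E)) : t ⊆ s := by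
  have hne := C.nonempty_of_mem_faces ht
  exact subset_of_centroid_mem_convexHull (C.indep ht) hne
    (C.inter_subset_convexHull ht hs ⟨t.centroid_mem_convexHull hne, h⟩)

theorem IsFace.subset_of_centroid_mem (hF : IsFace P F) (ht : t.Nonempty) (htP : (t : Set E) ⊆ P)
    (h : t.centroid ℝ id ∈ F) : (t : Set E) ⊆ F := by
  obtain ⟨l, c, hl, rfl⟩ := hF.exists_eq_sep
  exact fun y hy => ⟨htP hy, eqOn_of_apply_centroid_eq (φ := l.toLinearMap.toAffineMap)
    (fun z hz => hl z (htP hz)) ht h.2 y hy⟩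

theorem subset_of_mem_restrictFaces (ht : t ∈ restrictFaces C P) : (t : Set E) ⊆ P :=
  (subset_convexHull ℝ _).trans ht.2

theorem mem_restrictFaces_of_subset (hs : s ∈ restrictFaces C P) (hts : t ⊆ s)
    (ht : t.Nonempty) : t ∈ restrictFaces C P :=
  ⟨C.down_closed hs.1 hts ht, (convexHull_mono (Finset.coe_subset.2 hts)).trans hs.2⟩

theorem mem_restrictFaces_iff_of_isFace (hP : Convex ℝ P) (hF : IsFace P F) :
    t ∈ restrictFaces C F ↔ t ∈ restrictFaces C P ∧ (t : Set E) ⊆ F :=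
  ⟨fun ht => ⟨⟨ht.1, ht.2.trans hF.subset⟩, subset_of_mem_restrictFaces ht⟩,
    fun ht => ⟨ht.1.1, convexHull_min ht.2 (hF.2.convex hP)⟩⟩

/-- `C` triangulates every face `F` of `P` in such a way that the point `v F` is a vertex of all
the full-dimensional simplices of the triangulation of `F`. This is the part of the notion of a
pointed triangulation that the decomposition theorem rests on; simplices of `C` outside `P` are
allowed, so that the notion passes to the faces of `P`. -/
structure IsApexTriangulation (P : Set E) (C : SimplicialComplex ℝ E) (v : Set E → E) :
    Prop where
  finite : C.faces.Finite
  triangulates : ∀ F, IsFace P F → ⋃ s ∈ restrictFaces C F, convexHull ℝ (s : Set E) = F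
  apex_mem : ∀ F, IsFace P F → ∀ s ∈ restrictFaces C F, s.card = dim F + 1 → v F ∈ s

theorem IsPointedTriangulation.isApexTriangulation (h : IsPointedTriangulation P C v) :
    IsApexTriangulation P C v where
  finite := h.finite
  triangulates := h.triangulates
  apex_mem F hF s hs hcard := extremePoints_convexHull_subset <|
    inter_extremePoints_subset_extremePoints_of_subset hs.2
      ⟨h.apex_mem_simplex F hF s hs hcard, h.apex_mem_vertices F hF⟩

namespace IsApexTriangulation

theorem finite_restrictFaces (h : IsApexTriangulation P C v) : (restrictFaces C P).Finite :=
  h.finite.subset fun _ ht => ht.1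

theorem of_isFace (h : IsApexTriangulation P C v) (hP : IsPolytope P) (hF : IsFace P F) :
    IsApexTriangulation F C v where
  finite := h.finite
  triangulates G hG := h.triangulates G (hF.trans hP hG)
  apex_mem G hG := h.apex_mem G (hF.trans hP hG)

variable [FiniteDimensional ℝ E]

theorem exists_mem_convexHull (h : IsApexTriangulation P C v) (hP : Convex ℝ P) {x : E}
    (hx : x ∈ P) : ∃ s ∈ restrictFaces C P, v P ∈ s ∧ x ∈ convexHull ℝ (s : Set E) := by
  have hPP := IsFace.refl ⟨x, hx⟩
  obtain ⟨s, hs, hdim, hxs⟩ :=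
    exists_mem_convexHull_dim_eq hP h.finite_restrictFaces (h.triangulates P hPP) hx
  refine ⟨s, hs, h.apex_mem P hPP s hs ?_, hxs⟩
  rw [← hdim, dim_add_one_of_affineIndependent (C.indep hs.1) (C.nonempty_of_mem_faces hs.1)]

theorem singleton_apex_mem (h : IsApexTriangulation P C v) (hP : Convex ℝ P)
    (hne : P.Nonempty) : {v P} ∈ restrictFaces C P := by
  obtain ⟨s, hs, hv, -⟩ := h.exists_mem_convexHull hP hne.some_mem
  exact mem_restrictFaces_of_subset hs (by simpa using hv) (Finset.singleton_nonempty _)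

theorem insert_apex_mem [DecidableEq E] (h : IsApexTriangulation P C v) (hP : Convex ℝ P)
    (ht : t ∈ restrictFaces C P) : insert (v P) t ∈ restrictFaces C P := by
  have hcentroid := t.centroid_mem_convexHull (R := ℝ) (C.nonempty_of_mem_faces ht.1)
  obtain ⟨s, hs, hv, hx⟩ := h.exists_mem_convexHull hP (ht.2 hcentroid)
  exact mem_restrictFaces_of_subset hs
    (Finset.insert_subset hv (subset_of_centroid_mem ht.1 hs.1 hx)) (Finset.insert_nonempty _ _)

theorem apex_mem_carrier_iff (h : IsApexTriangulation P C v) (hP : IsPolytope P)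
    (ht : t ∈ restrictFaces C P) : v P ∈ carrier P t ↔ v P ∈ t := by
  refine ⟨fun hv => ?_, fun hv => subset_carrier P t hv⟩
  have hne := C.nonempty_of_mem_faces ht.1
  have hcentroid := t.centroid_mem_convexHull (R := ℝ) hne
  have hfaces : ∀ F, IsFace P F → t.centroid ℝ id ∈ F → v P ∈ F := fun F hF hx =>
    carrier_subset hF (hF.subset_of_centroid_mem hne (subset_of_mem_restrictFaces ht) hx) hv
  -- The segment from the apex through the centroid of `t` can be prolonged inside `P`, hence
  -- inside a simplex with vertex `v P`; the centroid of `t` is in the interior of this segment.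
  obtain ⟨ε, hε, hmem⟩ := hP.exists_pos_add_smul_mem (ht.2 hcentroid) hfaces
  obtain ⟨s, hs, hvs, hys⟩ := h.exists_mem_convexHull hP.convex hmem
  have hxs : t.centroid ℝ id ∈ convexHull ℝ (s : Set E) :=
    (convex_convexHull ℝ _).segment_subset hys (subset_convexHull ℝ _ hvs)
      (mem_segment_add_smul_sub hε.le _ _)
  exact mem_of_add_smul_mem_convexHull (C.indep hs.1) (subset_of_centroid_mem ht.1 hs.1 hxs) hvs
    hcentroid hε hys

end IsApexTriangulation

end ApexTriangulation

section LatticeCount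

variable {α : Type*} {T : Set (Finset α)} {x : α}

/-- The number of points of a set of open simplices, given by their sets of vertices, whose
barycentric coordinates are multiples of `1 / (m + 1)`: in a `k`-simplex these points correspond
to the ways of writing `m + 1` as an ordered sum of `k + 1` positive integers. -/
noncomputable def latticeCount (T : Set (Finset α)) (m : ℕ) : ℤ :=
  ∑ᶠ t ∈ T, (m.choose (t.card - 1) : ℤ)

theorem latticeCount_sep_add_latticeCount_sep_not (hT : T.Finite) (p : Finset α → Prop) (m : ℕ) :
    latticeCount {t ∈ T | p t} m + latticeCount {t ∈ T | ¬p t} m = latticeCount T m :=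
  finsum_mem_inter_add_sdiff {t | p t} hT

theorem latticeCount_eq_sum_ncard (hT : T.Finite) {d : ℕ} (hd : ∀ t ∈ T, t.card ≤ d + 1)
    (hne : ∀ t ∈ T, t.Nonempty) (m : ℕ) : latticeCount T m =
      ∑ k ∈ Finset.range (d + 1), ({t ∈ T | t.card = k + 1}.ncard : ℤ) * m.choose k := by
  have hfiber : T = ⋃ k ∈ (Finset.range (d + 1) : Set ℕ), {t ∈ T | t.card = k + 1} := by
    ext t
    simp only [mem_iUnion, Finset.coe_range, mem_Iio, mem_sep_iff, exists_prop]
    refine ⟨fun ht => ⟨t.card - 1, ?_⟩, fun ⟨_, _, ht, _⟩ => ht⟩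
    have := hd t ht
    have := (hne t ht).card_pos
    exact ⟨by omega, ht, by omega⟩
  have hdisj : (Finset.range (d + 1) : Set ℕ).PairwiseDisjoint
      fun k => {t ∈ T | t.card = k + 1} := fun i _ j _ hij =>
    disjoint_left.2 fun t hi hj => hij (Nat.succ_injective (hi.2.symm.trans hj.2))
  rw [latticeCount]
  conv_lhs => rw [hfiber]
  rw [finsum_mem_biUnion hdisj (Finset.finite_toSet _) fun k _ => hT.sep _, finsum_mem_coe_finset]
  refine Finset.sum_congr rfl fun k _ => ?_
  rw [finsum_mem_congr rfl (g := fun _ => (m.choose k : ℤ)) fun t ht => by rw [ht.2]; simp,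
    finsum_mem_eq_finite_toFinset_sum _ (hT.sep _), Finset.sum_const, nsmul_eq_mul,
    ncard_eq_toFinset_card _ (hT.sep _)]

/-- `T` is the set of nonempty simplices of a cone with apex `x`: it is stable under adding the
vertex `x`, and under removing it from any simplex other than the vertex `x` itself. -/
structure IsCone [DecidableEq α] (T : Set (Finset α)) (x : α) : Prop where
  singleton_mem : {x} ∈ T
  nonempty : ∀ t ∈ T, t.Nonempty
  insert_mem : ∀ t ∈ T, insert x t ∈ T
  erase_mem : ∀ t ∈ T, (t.erase x).Nonempty → t.erase x ∈ T

namespace IsCone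

variable [DecidableEq α]

theorem star_eq_insert_image (h : IsCone T x) :
    {t ∈ T | x ∈ t} = insert {x} (insert x '' {t ∈ T | x ∉ t}) := by
  ext t
  constructor
  · rintro ⟨ht, hx⟩
    rcases (t.erase x).eq_empty_or_nonempty with hempty | hne
    · exact Or.inl (by rw [← Finset.insert_erase hx, hempty, insert_empty_eq])
    · exact Or.inr ⟨t.erase x, ⟨h.erase_mem t ht hne, t.notMem_erase x⟩, Finset.insert_erase hx⟩
  · rintro (rfl | ⟨s, hs, rfl⟩)
    · exact ⟨h.singleton_mem, Finset.mem_singleton_self x⟩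
    · exact ⟨h.insert_mem s hs.1, Finset.mem_insert_self x s⟩

theorem latticeCount_star (h : IsCone T x) (hT : T.Finite) (m : ℕ) :
    latticeCount {t ∈ T | x ∈ t} m = 1 + ∑ᶠ t ∈ {t ∈ T | x ∉ t}, (m.choose t.card : ℤ) := by
  have hinj : InjOn (insert x) {t ∈ T | x ∉ t} := fun s hs t ht hst => by
    rw [← Finset.erase_insert hs.2, hst, Finset.erase_insert ht.2]
  have hnotMem : {x} ∉ insert x '' {t ∈ T | x ∉ t} := by
    rintro ⟨t, ht, htx⟩
    obtain ⟨y, hy⟩ := h.nonempty t ht.1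
    have hyx : y = x := by simpa [htx] using Finset.mem_insert_of_mem (b := x) hy
    exact ht.2 (hyx ▸ hy)
  rw [latticeCount, h.star_eq_insert_image,
    finsum_mem_insert _ hnotMem ((hT.sep _).image _), finsum_mem_image hinj]
  congr 1
  · simp
  · exact finsum_mem_congr rfl fun t ht => by simp [Finset.card_insert_of_notMem ht.2]

theorem latticeCount_star_zero (h : IsCone T x) (hT : T.Finite) :
    latticeCount {t ∈ T | x ∈ t} 0 = 1 := by
  rw [h.latticeCount_star hT, finsum_mem_congr rfl (g := fun _ => (0 : ℤ)), finsum_mem_zero,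
    add_zero]
  exact fun t ht => by simp [Nat.choose_eq_zero_of_lt (h.nonempty t ht.1).card_pos]

theorem latticeCount_star_add_one (h : IsCone T x) (hT : T.Finite) (m : ℕ) :
    latticeCount {t ∈ T | x ∈ t} (m + 1) = latticeCount T m := by
  have hpascal : ∀ t ∈ {t ∈ T | x ∉ t}, ((m + 1).choose t.card : ℤ) =
      m.choose t.card + m.choose (t.card - 1) := fun t ht => by
    have hcard := Nat.succ_pred_eq_of_pos (h.nonempty t ht.1).card_pos
    rw [← hcard, Nat.choose_succ_succ]
    simp [add_comm]
  rw [h.latticeCount_star hT, finsum_mem_congr rfl hpascal, finsum_mem_add_distrib (hT.sep _),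
    ← add_assoc, ← h.latticeCount_star hT]
  exact latticeCount_sep_add_latticeCount_sep_not hT (x ∈ ·) m

end IsCone

end LatticeCount

section Recursion

variable {E : Type*} [NormedAddCommGroup E] [NormedSpace ℝ E] [FiniteDimensional ℝ E] {P F : Set E}
  {v : Set E → E}

theorem setOf_isFace_ne_eq_empty (hdim : dim P = 0) : {F | IsFace P F ∧ F ≠ P} = ∅ :=
  eq_empty_of_forall_notMem fun _ hF => (dim_lt_of_isFace hF.1 hF.2).not_ge (by simp [hdim])

theorem polytopeNumber_add_two (hv : v P ∈ P) (m : ℕ) :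
    polytopeNumber v P (m + 2) = polytopeNumber v P (m + 1) +
      ∑ᶠ F ∈ {F | IsFace P F ∧ v P ∉ F}, interiorNumber v F (m + 2) := by
  have hset : {F | IsFace P F ∧ v P ∉ F} = {F | (IsFace P F ∧ F ≠ P) ∧ v P ∉ F} := by
    ext F
    exact ⟨fun hF => ⟨⟨hF.1, fun h => hF.2 (h ▸ hv)⟩, hF.2⟩, fun hF => ⟨hF.1.1, hF.2⟩⟩
  rw [hset]
  by_cases hdim : dim P = 0
  · have hempty : {F | (IsFace P F ∧ F ≠ P) ∧ v P ∉ F} = ∅ :=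
      subset_empty_iff.1 fun F hF => setOf_isFace_ne_eq_empty hdim ▸ hF.1
    rw [hempty, finsum_mem_empty, add_zero]
    cases m <;> simp [polytopeNumber, hdim]
  · rw [polytopeNumber, if_neg hdim, ← finsum_set_coe_eq_finsum_mem]
    rfl

theorem interiorNumber_add_two (v : Set E → E) (P : Set E) (m : ℕ) :
    interiorNumber v P (m + 2) = polytopeNumber v P (m + 2) -
      ∑ᶠ F ∈ {F | IsFace P F ∧ F ≠ P}, interiorNumber v F (m + 2) := by
  by_cases hdim : dim P = 0
  · rw [setOf_isFace_ne_eq_empty hdim, finsum_mem_empty, interiorNumber, polytopeNumber]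
    simp [hdim]
  · rw [interiorNumber, if_neg hdim, if_neg (by omega), ← finsum_set_coe_eq_finsum_mem]
    rfl

end Recursion

section Counting

variable {E : Type*} [NormedAddCommGroup E] [NormedSpace ℝ E] {P F : Set E}
  {C : SimplicialComplex ℝ E} {v : Set E → E} {t : Finset E}

/-- The simplices of `C` contained in `F` but in no proper face of `F`. -/
def interiorFaces (C : SimplicialComplex ℝ E) (F : Set E) : Set (Finset E) :=
  {t ∈ restrictFaces C F | carrier F t = F}

theorem mem_interiorFaces_iff_of_isFace (hP : IsPolytope P) (hF : IsFace P F) :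
    t ∈ interiorFaces C F ↔ t ∈ restrictFaces C P ∧ carrier P t = F := by
  rw [interiorFaces, mem_sep_iff, mem_restrictFaces_iff_of_isFace hP.convex hF, and_assoc]
  refine and_congr_right fun ht => ⟨fun ⟨htF, hc⟩ => ?_, fun hc => ?_⟩
  · rwa [← hP.carrier_eq_of_isFace hF (C.nonempty_of_mem_faces ht.1) htF]
  · have htF : (t : Set E) ⊆ F := hc ▸ subset_carrier P t
    exact ⟨htF, by rwa [hP.carrier_eq_of_isFace hF (C.nonempty_of_mem_faces ht.1) htF]⟩

namespace IsApexTriangulation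

theorem finsum_latticeCount_interiorFaces (h : IsApexTriangulation P C v) (hP : IsPolytope P)
    (p : Set E → Prop) (m : ℕ) :
    ∑ᶠ F ∈ {F | IsFace P F ∧ p F}, latticeCount (interiorFaces C F) m =
      latticeCount {t ∈ restrictFaces C P | p (carrier P t)} m := by
  have hdisj : {F | IsFace P F ∧ p F}.PairwiseDisjoint (interiorFaces C) :=
    fun F hF G hG hFG => disjoint_left.2 fun t htF htG => hFG <|
      ((mem_interiorFaces_iff_of_isFace hP hF.1).1 htF).2.symm.trans
        ((mem_interiorFaces_iff_of_isFace hP hG.1).1 htG).2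
  have hunion : {t ∈ restrictFaces C P | p (carrier P t)} =
      ⋃ F ∈ {F | IsFace P F ∧ p F}, interiorFaces C F := by
    ext t
    simp only [mem_iUnion, exists_prop]
    constructor
    · rintro ⟨ht, hpt⟩
      have hface := hP.isFace_carrier (C.nonempty_of_mem_faces ht.1)
        (subset_of_mem_restrictFaces ht)
      exact ⟨_, ⟨hface, hpt⟩, (mem_interiorFaces_iff_of_isFace hP hface).2 ⟨ht, rfl⟩⟩
    · rintro ⟨F, ⟨hF, hpF⟩, ht⟩
      obtain ⟨htP, rfl⟩ := (mem_interiorFaces_iff_of_isFace hP hF).1 ht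
      exact ⟨htP, hpF⟩
  have hfin : ∀ F, (interiorFaces C F).Finite := fun F => h.finite.subset fun _ ht => ht.1.1
  rw [latticeCount, hunion, finsum_mem_biUnion hdisj (hP.finite_setOf_isFace.sep p)
    fun F _ => hfin F]
  rfl

variable [FiniteDimensional ℝ E]

theorem isCone_restrictFaces [DecidableEq E] (h : IsApexTriangulation P C v) (hP : Convex ℝ P)
    (hne : P.Nonempty) : IsCone (restrictFaces C P) (v P) where
  singleton_mem := h.singleton_apex_mem hP hne
  nonempty _ ht := C.nonempty_of_mem_faces ht.1
  insert_mem _ ht := h.insert_apex_mem hP ht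
  erase_mem t ht hne := mem_restrictFaces_of_subset ht (t.erase_subset _) hne

theorem polytopeNumber_add_one_of_forall_isFace (h : IsApexTriangulation P C v)
    (hP : IsPolytope P) (hne : P.Nonempty)
    (hfaces : ∀ F, IsFace P F → F ≠ P → ∀ m,
      interiorNumber v F (m + 2) = latticeCount (interiorFaces C F) m) (m : ℕ) :
    polytopeNumber v P (m + 1) = latticeCount {t ∈ restrictFaces C P | v P ∈ t} m := by
  classical
  have hcone := h.isCone_restrictFaces hP.convex hne
  have hfin := h.finite_restrictFaces (P := P)
  have hv : v P ∈ P := subset_of_mem_restrictFaces hcone.singleton_mem (by simp)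
  induction m with
  | zero => rw [hcone.latticeCount_star_zero hfin, zero_add, polytopeNumber]
  | succ m ih =>
    have havoid : ∑ᶠ F ∈ {F | IsFace P F ∧ v P ∉ F}, interiorNumber v F (m + 2) =
        latticeCount {t ∈ restrictFaces C P | v P ∉ t} m := by
      rw [finsum_mem_congr rfl fun F hF => hfaces F hF.1 (fun hFP => hF.2 (hFP ▸ hv)) m,
        h.finsum_latticeCount_interiorFaces hP (v P ∉ ·)]
      congr 1
      exact sep_ext_iff.2 fun t ht => (h.apex_mem_carrier_iff hP ht).not
    rw [polytopeNumber_add_two hv, ih, havoid, latticeCount_sep_add_latticeCount_sep_not hfin,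
      hcone.latticeCount_star_add_one hfin]

theorem interiorNumber_add_two_of_forall_isFace (h : IsApexTriangulation P C v)
    (hP : IsPolytope P) (hne : P.Nonempty)
    (hfaces : ∀ F, IsFace P F → F ≠ P → ∀ m,
      interiorNumber v F (m + 2) = latticeCount (interiorFaces C F) m) (m : ℕ) :
    interiorNumber v P (m + 2) = latticeCount (interiorFaces C P) m := by
  classical
  have hcone := h.isCone_restrictFaces hP.convex hne
  have hfin := h.finite_restrictFaces (P := P)
  have hsplit := latticeCount_sep_add_latticeCount_sep_not hfin (fun t => carrier P t = P) m
  rw [interiorNumber_add_two, h.polytopeNumber_add_one_of_forall_isFace hP hne hfaces,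
    hcone.latticeCount_star_add_one hfin, finsum_mem_congr rfl fun F hF => hfaces F hF.1 hF.2 m,
    h.finsum_latticeCount_interiorFaces hP (· ≠ P), ← hsplit]
  exact add_sub_cancel_right _ _

theorem interiorNumber_add_two (h : IsApexTriangulation P C v) (hP : IsPolytope P)
    (hne : P.Nonempty) (m : ℕ) :
    interiorNumber v P (m + 2) = latticeCount (interiorFaces C P) m := by
  induction hd : dim P using Nat.strong_induction_on generalizing P m with
  | h d ih =>
    subst hd
    exact h.interiorNumber_add_two_of_forall_isFace hP hne (fun F hF hFP m =>
      ih _ (dim_lt_of_isFace hF hFP) (h.of_isFace hP hF) (hP.of_isFace hF) hF.1 m rfl) m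

theorem polytopeNumber_add_one (h : IsApexTriangulation P C v) (hP : IsPolytope P)
    (hne : P.Nonempty) (m : ℕ) :
    polytopeNumber v P (m + 1) = latticeCount {t ∈ restrictFaces C P | v P ∈ t} m :=
  h.polytopeNumber_add_one_of_forall_isFace hP hne (fun _ hF _ =>
    (h.of_isFace hP hF).interiorNumber_add_two (hP.of_isFace hF) hF.1) m

end IsApexTriangulation

end Counting

theorem latticeCount_setOf_subset_insert {α : Type*} [DecidableEq α] {a : α} {u : Finset α}
    (ha : a ∉ u) (m : ℕ) :
    latticeCount {t | t ⊆ insert a u ∧ a ∈ t} m = (m + u.card).choose u.card := by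
  have hnotMem : ∀ t ∈ u.powerset, a ∉ t := fun t ht hat => ha (Finset.mem_powerset.1 ht hat)
  have hset : {t | t ⊆ insert a u ∧ a ∈ t} = insert a '' (u.powerset : Set (Finset α)) := by
    ext t
    constructor
    · exact fun ⟨htu, hat⟩ => ⟨t.erase a,
        Finset.mem_coe.2 (Finset.mem_powerset.2 (Finset.subset_insert_iff.1 htu)),
        Finset.insert_erase hat⟩
    · rintro ⟨t, ht, rfl⟩
      exact ⟨Finset.insert_subset_insert a (Finset.mem_powerset.1 ht), Finset.mem_insert_self a t⟩
  have hinj : InjOn (insert a) (u.powerset : Set (Finset α)) := fun t ht t' ht' h => by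
    rw [← Finset.erase_insert (hnotMem t ht), h, Finset.erase_insert (hnotMem t' ht')]
  rw [latticeCount, hset, finsum_mem_image hinj, finsum_mem_coe_finset]
  calc ∑ t ∈ u.powerset, (m.choose ((insert a t).card - 1) : ℤ)
      = ∑ t ∈ u.powerset, (m.choose t.card : ℤ) := Finset.sum_congr rfl fun t ht => by
        rw [Finset.card_insert_of_notMem (hnotMem t ht), Nat.add_sub_cancel]
    _ = ∑ j ∈ Finset.range (u.card + 1), (m.choose j * u.card.choose (u.card - j) : ℤ) := by
        rw [Finset.sum_powerset_apply_card fun j => (m.choose j : ℤ)]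
        refine Finset.sum_congr rfl fun j hj => ?_
        rw [Nat.choose_symm (Finset.mem_range_succ_iff.1 hj), nsmul_eq_mul, mul_comm]
    _ = (m + u.card).choose u.card := by
        rw [Nat.add_choose_eq, Finset.Nat.sum_antidiagonal_eq_sum_range_succ_mk]
        push_cast
        rfl

section Simplex

variable {E : Type*} [NormedAddCommGroup E] [NormedSpace ℝ E] {F : Set E} {v : Set E → E}
  {s t : Finset E}

/-- The complex of all the faces of the simplex with vertex set `s`. -/
def simplexComplex (s : Finset E) (hs : AffineIndependent ℝ ((↑) : s → E)) :
    SimplicialComplex ℝ E where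
  faces := {t | t ⊆ s ∧ t.Nonempty}
  isRelLowerSet_faces _ ht := ⟨ht.2, fun _ hut hu => ⟨hut.trans ht.1, hu⟩⟩
  indep ht := hs.mono ht.1
  inter_subset_convexHull ht hu := by
    classical exact (hs.convexHull_inter ht.1 hu.1).ge

theorem isApexTriangulation_simplexComplex (hs : AffineIndependent ℝ ((↑) : s → E))
    (hv : ∀ F, IsFace (convexHull ℝ (s : Set E)) F → v F ∈ (s : Set E) ∩ F) :
    IsApexTriangulation (convexHull ℝ (s : Set E)) (simplexComplex s hs) v where
  finite := s.powerset.finite_toSet.subset fun _ ht => Finset.mem_powerset.2 ht.1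
  triangulates F hF := by
    classical
    refine subset_antisymm (iUnion₂_subset fun t ht => ht.2) ?_
    have hface : (s.filter (· ∈ F) : Set E) = (s : Set E) ∩ F := Finset.coe_filter _ _
    have hmem : s.filter (· ∈ F) ∈ restrictFaces (simplexComplex s hs) F :=
      ⟨⟨s.filter_subset _, v F, by simpa using hv F hF⟩,
        by rw [hface, ← hF.eq_convexHull_inter s.finite_toSet]⟩
    nth_rw 1 [hF.eq_convexHull_inter s.finite_toSet, ← hface]
    exact subset_biUnion_of_mem (u := fun t : Finset E => convexHull ℝ (t : Set E)) hmem
  apex_mem F hF t ht hcard := by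
    classical
    have hface : (s.filter (· ∈ F) : Set E) = (s : Set E) ∩ F := Finset.coe_filter _ _
    have hvF : v F ∈ s.filter (· ∈ F) := by simpa using hv F hF
    have hsub : t ⊆ s.filter (· ∈ F) := fun y hy =>
      Finset.mem_filter.2 ⟨ht.1.1 hy, subset_of_mem_restrictFaces ht hy⟩
    have hdim : dim F + 1 = (s.filter (· ∈ F)).card := by
      rw [← dim_add_one_of_affineIndependent (hs.mono (s.filter_subset _)) ⟨_, hvF⟩, hface,
        ← dim_convexHull ((s : Set E) ∩ F), ← hF.eq_convexHull_inter s.finite_toSet]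
    rwa [Finset.eq_of_subset_of_card_le hsub (by omega)]

theorem polytopeNumber_convexHull_of_affineIndependent [FiniteDimensional ℝ E]
    (hs : AffineIndependent ℝ ((↑) : s → E)) {k : ℕ} (hk : s.card = k + 1)
    (hv : ∀ F, IsFace (convexHull ℝ (s : Set E)) F → v F ∈ (s : Set E) ∩ F) (m : ℕ) :
    polytopeNumber v (convexHull ℝ (s : Set E)) (m + 1) = (m + k).choose k := by
  classical
  have hne : s.Nonempty := Finset.card_pos.1 (by omega)
  have hhull : (convexHull ℝ (s : Set E)).Nonempty := convexHull_nonempty_iff.2 hne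
  have hvs : v (convexHull ℝ (s : Set E)) ∈ s := (hv _ (IsFace.refl hhull)).1
  set a := v (convexHull ℝ (s : Set E)) with ha
  have hset : {t ∈ restrictFaces (simplexComplex s hs) (convexHull ℝ (s : Set E)) | a ∈ t} =
      {t | t ⊆ insert a (s.erase a) ∧ a ∈ t} := by
    rw [Finset.insert_erase hvs]
    ext t
    exact ⟨fun ht => ⟨ht.1.1.1, ht.2⟩, fun ht =>
      ⟨⟨⟨ht.1, a, ht.2⟩, convexHull_mono (Finset.coe_subset.2 ht.1)⟩, ht.2⟩⟩
  rw [(isApexTriangulation_simplexComplex hs hv).polytopeNumber_add_one ⟨s, s.finite_toSet, rfl⟩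
    hhull, ← ha, hset, latticeCount_setOf_subset_insert (s.notMem_erase a),
    Finset.card_erase_of_mem hvs, hk, Nat.add_sub_cancel]

end Simplex

section StandardSimplex

theorem convex_insert_setOf_lt {𝕜 V : Type*} [Field 𝕜] [LinearOrder 𝕜] [IsStrictOrderedRing 𝕜]
    [AddCommGroup V] [Module 𝕜 V] (φ : V →ₗ[𝕜] 𝕜) (b : V) :
    Convex 𝕜 (insert b {z | φ b < φ z}) := by
  have hcomb : ∀ {p q y z : 𝕜}, 0 < p → 0 < q → p + q = 1 → φ b ≤ y → φ b < z →
      φ b < p * y + q * z := fun {p q y z} hp hq hpq hy hz =>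
    calc φ b = p * φ b + q * φ b := by rw [← add_mul, hpq, one_mul]
      _ < p * y + q * z := add_lt_add_of_le_of_lt (by gcongr) (by gcongr)
  refine convex_iff_forall_pos.2 ?_
  rintro y (rfl | hy) z (rfl | hz) p q hp hq hpq
  · exact Or.inl (Convex.combo_self hpq _)
  · exact Or.inr (by simpa using hcomb hp hq hpq le_rfl hz)
  · exact Or.inr (by simpa [add_comm] using hcomb hq hp (add_comm p q ▸ hpq) le_rfl hy)
  · exact Or.inr (by simpa using hcomb hp hq hpq (le_of_lt hy) hz)

theorem mem_of_mem_convexHull_of_forall_le {𝕜 V : Type*} [Field 𝕜] [LinearOrder 𝕜]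
    [IsStrictOrderedRing 𝕜] [AddCommGroup V] [Module 𝕜 V] {A : Set V} {φ : V →ₗ[𝕜] 𝕜}
    (hφ : InjOn φ A) {x : V} (hx : x ∈ convexHull 𝕜 A) (hmin : ∀ y ∈ A, φ x ≤ φ y) : x ∈ A := by
  obtain ⟨b, hb, hbx⟩ := (φ.concaveOn convex_univ).exists_le_of_mem_convexHull A.subset_univ hx
  have hsub : A ⊆ insert b {z | φ b < φ z} := fun y hy => or_iff_not_imp_left.2 fun hyb =>
    (hbx.trans (hmin y hy)).lt_of_ne fun h => hyb (hφ hb hy h).symm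
  rcases convexHull_min hsub (convex_insert_setOf_lt φ b) hx with rfl | hlt
  · exact hb
  · exact absurd (hmin b hb) (not_le.2 hlt)

theorem standardSimplexApex_mem {k : ℕ} {F : Set (EuclideanSpace ℝ (Fin (k + 1)))}
    (hF : IsFace (standardSimplex k) F) :
    standardSimplexApex k F ∈ range (fun i => EuclideanSpace.single i (1 : ℝ)) ∩ F := by
  let φ : EuclideanSpace ℝ (Fin (k + 1)) →ₗ[ℝ] ℝ :=
    ∑ i : Fin (k + 1), ((i : ℝ) + 1) • (EuclideanSpace.proj i).toLinearMap
  have hφ : ∀ x, φ x = ∑ i : Fin (k + 1), ((i : ℝ) + 1) * x i := fun x => by simp [φ]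
  set A : Set (EuclideanSpace ℝ (Fin (k + 1))) := range fun i => EuclideanSpace.single i (1 : ℝ)
  have hinj : InjOn φ A := by
    rintro _ ⟨i, rfl⟩ _ ⟨j, rfl⟩ hij
    have : i = j := by simpa [hφ, Fin.val_inj] using hij
    rw [this]
  have hhull : F = convexHull ℝ (A ∩ F) := hF.eq_convexHull_inter (finite_range _)
  obtain ⟨b, hb, hbmin⟩ := exists_min_image (A ∩ F) φ ((finite_range _).inter_of_left F)
    (convexHull_nonempty_iff.1 (hhull ▸ hF.1))
  have hmin : ∃ x, x ∈ F ∧ ∀ y ∈ F, φ x ≤ φ y :=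
    ⟨b, hb.2, fun y hy => by
      rw [hhull] at hy
      exact convexHull_min (t := {z | φ b ≤ φ z}) hbmin (convex_halfSpace_ge φ.isLinear _) hy⟩
  obtain ⟨hvF, hvmin⟩ :
      standardSimplexApex k F ∈ F ∧ ∀ y ∈ F, φ (standardSimplexApex k F) ≤ φ y := by
    simp only [hφ] at hmin ⊢
    exact Classical.epsilon_spec hmin
  exact mem_of_mem_convexHull_of_forall_le (hinj.mono inter_subset_left) (hhull.subset hvF)
    fun y hy => hvmin y hy.2

theorem polytopeNumber_standardSimplex (k m : ℕ) :
    polytopeNumber (standardSimplexApex k) (standardSimplex k) (m + 1) = (m + k).choose k := by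
  classical
  let e : Fin (k + 1) → EuclideanSpace ℝ (Fin (k + 1)) := fun i => EuclideanSpace.single i 1
  have hlin : LinearIndependent ℝ e := (EuclideanSpace.orthonormal_single ..).linearIndependent
  have hrange : (Finset.univ.image e : Set (EuclideanSpace ℝ (Fin (k + 1)))) = range e := by simp
  have hind : AffineIndependent ℝ ((↑) : Finset.univ.image e → EuclideanSpace ℝ (Fin (k + 1))) :=
    hlin.affineIndependent.range.mono hrange.subset
  have hcard : (Finset.univ.image e).card = k + 1 := by
    simp [Finset.card_image_of_injective _ hlin.injective]
  have hhull : standardSimplex k = convexHull ℝ (Finset.univ.image e : Set _) := by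
    rw [hrange, standardSimplex]
  rw [hhull]
  refine polytopeNumber_convexHull_of_affineIndependent hind hcard (fun F hF => ?_) m
  rw [hrange]
  exact standardSimplexApex_mem (hhull ▸ hF)

theorem simplexNumber_of_nonpos (k : ℕ) {m : ℤ} (hm : m ≤ 0) : simplexNumber k m = 0 := by
  rw [simplexNumber, Int.toNat_of_nonpos hm, polytopeNumber]

theorem simplexNumber_add_one_sub (k m : ℕ) : simplexNumber k ((m + 1 : ℕ) - k) = m.choose k := by
  rcases lt_or_ge m k with h | h
  · rw [Nat.choose_eq_zero_of_lt h, simplexNumber_of_nonpos k (by omega), Nat.cast_zero]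
  · obtain ⟨j, rfl⟩ := Nat.exists_eq_add_of_le' h
    rw [simplexNumber, show (((j + k + 1 : ℕ) : ℤ) - k).toNat = j + 1 by omega,
      polytopeNumber_standardSimplex]

end StandardSimplex

section Decomposition

variable {E : Type*} [NormedAddCommGroup E] [NormedSpace ℝ E] {P : Set E}
  {C : SimplicialComplex ℝ E} {v : Set E → E}

theorem mem_convexHull_iff_mem_of_singleton_mem_faces {x : E} (hx : {x} ∈ C.faces) {t : Finset E}
    (ht : t ∈ C.faces) : x ∈ convexHull ℝ (t : Set E) ↔ x ∈ t := by
  refine ⟨fun hxt => ?_, fun hxt => subset_convexHull ℝ _ hxt⟩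
  exact Finset.singleton_subset_iff.1 <| subset_of_centroid_mem hx ht <| by
    rwa [Finset.centroid_singleton, id]

theorem restrictFaces_eq_faces (h : C.space ⊆ P) : restrictFaces C P = C.faces :=
  subset_antisymm (fun _ ht => ht.1) fun _ ht => ⟨ht, (C.convexHull_subset_space ht).trans h⟩

theorem card_le_dim_add_one [FiniteDimensional ℝ E] {t : Finset E} (ht : t ∈ restrictFaces C P) :
    t.card ≤ dim P + 1 := by
  rw [← dim_add_one_of_affineIndependent (C.indep ht.1) (C.nonempty_of_mem_faces ht.1)]
  exact Nat.add_le_add_right (dim_le_of_subset_affineSpan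
    ((subset_of_mem_restrictFaces ht).trans (subset_affineSpan ℝ P))) 1

theorem IsApexTriangulation.simplicesThrough_apex_eq [FiniteDimensional ℝ E]
    (h : IsApexTriangulation P C v) (hP : Convex ℝ P) (hne : P.Nonempty) (hCP : C.space ⊆ P)
    (k : ℕ) : simplicesThrough C (v P) k =
      {t ∈ {t ∈ restrictFaces C P | v P ∈ t} | t.card = k + 1} := by
  have hv : {v P} ∈ C.faces := (h.singleton_apex_mem hP hne).1
  rw [restrictFaces_eq_faces hCP]
  ext t
  exact ⟨fun ⟨ht, hcard, hvt⟩ =>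
      ⟨⟨ht, (mem_convexHull_iff_mem_of_singleton_mem_faces hv ht).1 hvt⟩, hcard⟩,
    fun ⟨⟨ht, hvt⟩, hcard⟩ => ⟨ht, hcard, subset_convexHull ℝ _ hvt⟩⟩

end Decomposition

end PolytopeNumbers

open PolytopeNumbers in
theorem mainTheorem8_general {E : Type*} [NormedAddCommGroup E] [NormedSpace ℝ E]
    [FiniteDimensional ℝ E] {P : Set E} (hP : IsPolytope P) (hne : P.Nonempty)
    {C : Geometry.SimplicialComplex ℝ E} {v : Set E → E} (h : IsApexTriangulation P C v)
    (hCP : C.space ⊆ P) (n : ℕ) :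
    polytopeNumber v P n = ∑ k ∈ Finset.range (dim P + 1),
      ((simplicesThrough C (v P) k).ncard : ℤ) * simplexNumber k ((n : ℤ) - (k : ℤ)) := by
  cases n with
  | zero =>
    rw [polytopeNumber, Finset.sum_eq_zero fun k _ => ?_]
    rw [simplexNumber_of_nonpos k (by simp), mul_zero]
  | succ m =>
    rw [h.polytopeNumber_add_one hP hne, latticeCount_eq_sum_ncard (h.finite_restrictFaces.sep _)
      (fun t ht => card_le_dim_add_one ht.1) fun t ht => ⟨_, ht.2⟩]
    refine Finset.sum_congr rfl fun k _ => ?_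
    rw [simplexNumber_add_one_sub, h.simplicesThrough_apex_eq hP.convex hne hCP]

theorem mainTheorem8 {e : ℕ} (P : Set (EuclideanSpace ℝ (Fin e)))
    (hP : PolytopeNumbers.IsPolytope P) (hne : P.Nonempty)
    (C : Geometry.SimplicialComplex ℝ (EuclideanSpace ℝ (Fin e)))
    (v : Set (EuclideanSpace ℝ (Fin e)) → EuclideanSpace ℝ (Fin e))
    (hC : PolytopeNumbers.IsPointedTriangulation P C v) (n : ℕ) :
    PolytopeNumbers.polytopeNumber v P n =
      ∑ k ∈ Finset.range (PolytopeNumbers.dim P + 1),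
        ((PolytopeNumbers.simplicesThrough C (v P) k).ncard : ℤ) *
          PolytopeNumbers.simplexNumber k ((n : ℤ) - (k : ℤ)) :=
  mainTheorem8_general hP hne hC.isApexTriangulation hC.space_eq.subset n
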